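/- Let $2/3<\gamma\le 4/3$. Consider a tilted perfect fluid Bianchi type VII$_0$ model with equation-of-state parameter $\gamma$, described (in the gauge $\phi'=0$) by the expansion-normalised variables $\Sigma_+,\bar N,v_1,\Omega\in\mathbb R$ and $\mathbf\Sigma_\times,\mathbf\Sigma_1,\mathbf N_\times,\mathbf v\in\mathbb C$ as functions of the dimensionless time $\tau$. Write $$V^2=v_1^2+|\mathbf v|^2,\quad V\ge 0,\quad G_+=1+(\gamma-1)V^2,\quad \Sigma^2=\Sigma_+^2+|\mathbf\Sigma_\times|^2+|\mathbf\Sigma_1|^2,\quad \sigma_1=|\mathbf N_\times|^2+|\mathbf\Sigma_\times|^2,$$ $$V^2\mathcal S=\Sigma_+(-2v_1^2+|\mathbf v|^2)+2\sqrt3\,v_1\mathrm{Re}(\mathbf\Sigma_1\mathbf v^*)+\sqrt3\,\mathrm{Re}(\mathbf\Sigma_\times(\mathbf v^*)^2),$$ $$q=2\Sigma^2+\tfrac12\,\frac{(3\gamma-2)+(2-\gamma)V^2}{G_+}\,\Omega,\qquad T=\frac{(3\gamma-4)(1-V^2)+(2-\gamma)V^2\mathcal S}{1-(\gamma-1)V^2}.$$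 Suppose that for all $\tau>\tau_0$ the variables satisfy the evolution equations $$\begin{aligned} \Sigma_+'&=(q-2)\Sigma_++3|\mathbf\Sigma_1|^2-2|\mathbf N_\times|^2+\tfrac{\gamma\Omega}{2G_+}(-2v_1^2+|\mathbf v|^2),\\ \mathbf\Sigma_\times'&=(q-2)\mathbf\Sigma_\times+\sqrt3\,\mathbf\Sigma_1^2-2\sqrt3\,\mathbf N_\times\bar N+\tfrac{\sqrt3\gamma\Omega}{2G_+}\mathbf v^2,\\ \mathbf\Sigma_1'&=(q-2-3\Sigma_+)\mathbf\Sigma_1-\sqrt3\,\mathbf\Sigma_\times\mathbf\Sigma_1^*+\tfrac{\sqrt3\gamma\Omega v_1}{G_+}\mathbf v,\\ \mathbf N_\times'&=(q+2\Sigma_+)\mathbf N_\times+2\sqrt3\,\mathbf\Sigma_\times\bar N,\\ \bar N'&=(q+2\Sigma_+)\bar N+2\sqrt3\,\mathrm{Re}(\mathbf\Sigma_\times^*\mathbf N_\times),\\ \Omega'&=\tfrac{\Omega}{G_+}\{2q-(3\gamma-2)+[2q(\gamma-1)-(2-\gamma)]V^2-\gamma V^2\mathcal S\},\\ v_1'&=(T+2\Sigma_+)v_1-2\sqrt3\,\mathrm{Re}(\mathbf\Sigma_1\mathbf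 v^*)+\sqrt3\,\mathrm{Im}(\mathbf N_\times^*\mathbf v^2),\\ \mathbf v'&=(T-\Sigma_+-i\sqrt3\,\bar Nv_1)\mathbf v-\sqrt3(\mathbf\Sigma_\times+i\mathbf N_\times v_1)\mathbf v^* \end{aligned}$$ and the constraints $$1=\Sigma^2+|\mathbf N_\times|^2+\Omega,\qquad 0=2\,\mathrm{Im}(\mathbf\Sigma_\times^*\mathbf N_\times)+\tfrac{\gamma\Omega v_1}{G_+},\qquad 0=i\mathbf\Sigma_1\bar N+i\mathbf\Sigma_1^*\mathbf N_\times+\tfrac{\gamma\Omega\mathbf v}{G_+},$$ and that $\bar N^2-|\mathbf N_\times|^2>0$ (type VII$_0$), $\Omega>0$ and $V<1$ for all $\tau>\tau_0$. Suppose also that $\bar N\to\infty$ as $\tau\to\infty$. Then: 1. if $2/3<\gamma<4/3$, then $\lim_{\tau\to\infty}(\Sigma_+,V,\sigma_1)=(0,0,0)$; 2. if $\gamma=4/3$, then $\lim_{\tau\to\infty}\Sigma_+=0$. -/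

import Mathlib

open scoped ComplexConjugate Topology

noncomputable section

namespace BianchiVII0

/-- Expansion-normalised variables of a tilted Bianchi type VII₀ perfect fluid model (F-gauge):
shear `Σ₊, Σ_×, Σ₁`, curvature `N_×, N̄`, tilt `v₁, v = v₂ + i v₃`, energy density `Ω`. -/
structure State where
  sigmaPlus : ℝ
  sigmaCross : ℂ
  sigmaOne : ℂ
  nCross : ℂ
  nBar : ℝ
  vOne : ℝ
  vC : ℂ
  omega : ℝ

namespace State

/-- `V² = v₁² + |v|²`. -/
def Vsq (x : State) : ℝ := x.vOne ^ 2 + ‖x.vC‖ ^ 2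

/-- The tilt speed `V ≥ 0`. -/
def V (x : State) : ℝ := √x.Vsq

/-- `Σ² = Σ₊² + |Σ_×|² + |Σ₁|²`. -/
def SigmaSq (x : State) : ℝ := x.sigmaPlus ^ 2 + ‖x.sigmaCross‖ ^ 2 + ‖x.sigmaOne‖ ^ 2

/-- `σ₁ = |N_×|² + |Σ_×|²`, half the sum of the squared moduli of `Σ_× ± i N_×`. -/
def sigma1 (x : State) : ℝ := ‖x.nCross‖ ^ 2 + ‖x.sigmaCross‖ ^ 2

/-- `G₊ = 1 + (γ - 1) V²`. -/
def Gplus (γ : ℝ) (x : State) : ℝ := 1 + (γ - 1) * x.Vsq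

/-- `V² 𝒮 = Σ_ab v^a v^b`, where `Σ_ab` is the trace-free symmetric matrix with
`Σ_11 = -2 Σ₊`, `Σ_12 + i Σ_13 = √3 Σ₁`, `Σ_22 = Σ₊ + √3 Re Σ_×`, `Σ_33 = Σ₊ - √3 Re Σ_×`,
`Σ_23 = √3 Im Σ_×`. The scalar `𝒮` enters the evolution equations only through this product. -/
def VsqS (x : State) : ℝ :=
  x.sigmaPlus * (-2 * x.vOne ^ 2 + ‖x.vC‖ ^ 2)
    + 2 * √3 * x.vOne * (x.sigmaOne * conj x.vC).re
    + √3 * (x.sigmaCross * conj x.vC ^ 2).re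

/-- The deceleration parameter `q`. -/
def q (γ : ℝ) (x : State) : ℝ :=
  2 * x.SigmaSq + 1 / 2 * (((3 * γ - 2) + (2 - γ) * x.Vsq) / x.Gplus γ) * x.omega

/-- The scalar `T` of the tilt evolution equations. -/
def T (γ : ℝ) (x : State) : ℝ :=
  ((3 * γ - 4) * (1 - x.Vsq) + (2 - γ) * x.VsqS) / (1 - (γ - 1) * x.Vsq)

/-- The state is of Bianchi type VII₀ (`N̄² - |N_×|² > 0`), contains a fluid (`Ω > 0`) whose tilt is
not extreme (`V < 1`), and satisfies the Hamiltonian and momentum constraints. -/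
structure IsAdmissible (γ : ℝ) (x : State) : Prop where
  typeVII0 : 0 < x.nBar ^ 2 - ‖x.nCross‖ ^ 2
  omega_pos : 0 < x.omega
  V_lt_one : x.V < 1
  hamiltonian : 1 = x.SigmaSq + ‖x.nCross‖ ^ 2 + x.omega
  momentum_one : 0 = 2 * (conj x.sigmaCross * x.nCross).im + γ * x.omega * x.vOne / x.Gplus γ
  momentum_cross : 0 = Complex.I * x.sigmaOne * (x.nBar : ℂ)
    + Complex.I * conj x.sigmaOne * x.nCross
    + ((γ * x.omega / x.Gplus γ : ℝ) : ℂ) * x.vC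

end State

/-- The curve `X`, as a function of the dimensionless time `τ`, satisfies the evolution equations of
the tilted Bianchi type VII₀ model with equation-of-state parameter `γ` at time `τ`. (The
evolution equation of `V` follows from those of `v₁` and `v`.) -/
structure EvolvesAt (γ : ℝ) (X : ℝ → State) (τ : ℝ) : Prop where
  sigmaPlus : HasDerivAt (fun t => (X t).sigmaPlus)
    (((X τ).q γ - 2) * (X τ).sigmaPlus + 3 * ‖(X τ).sigmaOne‖ ^ 2 - 2 * ‖(X τ).nCross‖ ^ 2
      + γ * (X τ).omega / (2 * (X τ).Gplus γ) * (-2 * (X τ).vOne ^ 2 + ‖(X τ).vC‖ ^ 2)) τ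
  sigmaCross : HasDerivAt (fun t => (X t).sigmaCross)
    ((((X τ).q γ - 2 : ℝ) : ℂ) * (X τ).sigmaCross + ((√3 : ℝ) : ℂ) * (X τ).sigmaOne ^ 2
      - ((2 * √3 * (X τ).nBar : ℝ) : ℂ) * (X τ).nCross
      + ((√3 * γ * (X τ).omega / (2 * (X τ).Gplus γ) : ℝ) : ℂ) * (X τ).vC ^ 2) τ
  sigmaOne : HasDerivAt (fun t => (X t).sigmaOne)
    ((((X τ).q γ - 2 - 3 * (X τ).sigmaPlus : ℝ) : ℂ) * (X τ).sigmaOne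
      - ((√3 : ℝ) : ℂ) * (X τ).sigmaCross * conj (X τ).sigmaOne
      + ((√3 * γ * (X τ).omega * (X τ).vOne / (X τ).Gplus γ : ℝ) : ℂ) * (X τ).vC) τ
  nCross : HasDerivAt (fun t => (X t).nCross)
    ((((X τ).q γ + 2 * (X τ).sigmaPlus : ℝ) : ℂ) * (X τ).nCross
      + ((2 * √3 * (X τ).nBar : ℝ) : ℂ) * (X τ).sigmaCross) τ
  nBar : HasDerivAt (fun t => (X t).nBar)
    (((X τ).q γ + 2 * (X τ).sigmaPlus) * (X τ).nBar
      + 2 * √3 * (conj (X τ).sigmaCross * (X τ).nCross).re) τ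
  omega : HasDerivAt (fun t => (X t).omega)
    ((X τ).omega / (X τ).Gplus γ * (2 * (X τ).q γ - (3 * γ - 2)
      + (2 * (X τ).q γ * (γ - 1) - (2 - γ)) * (X τ).Vsq - γ * (X τ).VsqS)) τ
  vOne : HasDerivAt (fun t => (X t).vOne)
    (((X τ).T γ + 2 * (X τ).sigmaPlus) * (X τ).vOne
      - 2 * √3 * ((X τ).sigmaOne * conj (X τ).vC).re
      + √3 * (conj (X τ).nCross * (X τ).vC ^ 2).im) τ
  vC : HasDerivAt (fun t => (X t).vC)
    ((((X τ).T γ - (X τ).sigmaPlus : ℝ) - Complex.I * ((√3 * (X τ).nBar * (X τ).vOne : ℝ) : ℂ))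
        * (X τ).vC
      - ((√3 : ℝ) : ℂ) * ((X τ).sigmaCross + Complex.I * (X τ).nCross * ((X τ).vOne : ℂ))
        * conj (X τ).vC) τ

/-- A tilted Bianchi type VII₀ perfect fluid model with `Ω > 0` and `V < 1`, followed for all times
`τ > τ₀`: a curve of admissible states solving the evolution equations. -/
def IsModel (γ τ₀ : ℝ) (X : ℝ → State) : Prop :=
  ∀ τ > τ₀, (X τ).IsAdmissible γ ∧ EvolvesAt γ X τ

end BianchiVII0

end

/-! The proof rests on `restDensity`, called Q here: 0 < Q ≤ 1, and particle conservation gives (log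
Q)' = 2q + 2 - 3γ. The Hamiltonian constraint turns the right side into (6-3γ)(Σ₊² + |Σ₁|²) +
(4-3γ)(σ₁ + γΩV²/G₊), which is nonnegative for γ ≤ 4/3, plus the term 2(|Σ_×|² - |N_×|²) of no
definite sign (`two_q_sub`).

That term averages out. The pair Σ_×, N_× rotates at a rate proportional to N̄, so 2(|Σ_×|² -
|N_×|²) is the derivative of Re(Σ_×^* N_×)/(√3 N̄) up to O(1/N̄) (`hasDerivAt_correction`).
Subtracting this small `correction` from log Q gives `averagedLogDensity`, which increases up to an
error O(1/N̄).

For γ < 4/3 its derivative is at least (4-3γ)(1-Q) - O(1/N̄), which forces Q → 1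
(`tendsto_restDensity`). Since 1-Q bounds Σ₊², σ₁ and, once Ω ≥ 1/2, a multiple of V², all three
limits follow.

For γ = 4/3 only 2(Σ₊² + |Σ₁|²) survives. The error must then be integrable, which follows from
exponential growth of N̄ (`exists_inv_nBar_le`). A bounded function thus grows at least at the rate
Σ₊², and since Σ₊' is bounded, Σ₊ → 0 (`tendsto_zero_of_sq_le_deriv`). -/

namespace BianchiVII0

/-! ### Pointwise bounds on admissible states and on the rest density. -/

namespace State

variable {γ : ℝ} {x : State}

/-- `Re (Σ_×^* N_×)`, whose rapid oscillation drives that of `|Σ_×|² - |N_×|²`. -/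
def crossRe (x : State) : ℝ := (conj x.sigmaCross * x.nCross).re

/-- `Ω (1 - V²)^(1 - γ/2) / G₊`, the conserved particle number density raised to the power `γ` and
normalised by the expansion. -/
noncomputable def restDensity (γ : ℝ) (x : State) : ℝ :=
  x.omega * (1 - x.Vsq) ^ (1 - γ / 2) / x.Gplus γ

lemma Vsq_nonneg (x : State) : 0 ≤ x.Vsq := by unfold Vsq; positivity

lemma SigmaSq_nonneg (x : State) : 0 ≤ x.SigmaSq := by unfold SigmaSq; positivity

lemma IsAdmissible.Vsq_lt_one (h : x.IsAdmissible γ) : x.Vsq < 1 := by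
  have h1 := h.V_lt_one
  unfold V at h1
  rwa [Real.sqrt_lt' one_pos, one_pow] at h1

lemma IsAdmissible.Gplus_ge (hγ : 2 / 3 < γ) (h : x.IsAdmissible γ) : 2 / 3 ≤ x.Gplus γ := by
  have := h.Vsq_lt_one
  have := x.Vsq_nonneg
  unfold Gplus
  nlinarith

lemma IsAdmissible.Gplus_le (hγ' : γ ≤ 4 / 3) (h : x.IsAdmissible γ) : x.Gplus γ ≤ 4 / 3 := by
  have := h.Vsq_lt_one
  have := x.Vsq_nonneg
  unfold Gplus
  nlinarith

lemma IsAdmissible.constraint (h : x.IsAdmissible γ) :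
    x.sigmaPlus ^ 2 + ‖x.sigmaOne‖ ^ 2 + x.sigma1 + x.omega = 1 := by
  have := h.hamiltonian
  unfold SigmaSq at this
  unfold sigma1
  linarith

lemma sigma1_nonneg (x : State) : 0 ≤ x.sigma1 := by unfold sigma1; positivity

lemma IsAdmissible.omega_le (h : x.IsAdmissible γ) : x.omega ≤ 1 := by
  have := h.constraint
  have := x.sigma1_nonneg
  nlinarith [sq_nonneg x.sigmaPlus, sq_nonneg ‖x.sigmaOne‖]

lemma IsAdmissible.abs_sigmaPlus_le (h : x.IsAdmissible γ) : |x.sigmaPlus| ≤ 1 := by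
  have := h.constraint
  have := x.sigma1_nonneg
  have := h.omega_pos
  rw [← sq_le_one_iff_abs_le_one]
  nlinarith [sq_nonneg ‖x.sigmaOne‖]

lemma IsAdmissible.norm_sigmaOne_le (h : x.IsAdmissible γ) : ‖x.sigmaOne‖ ≤ 1 := by
  have := h.constraint
  have := x.sigma1_nonneg
  have := h.omega_pos
  rw [← sq_le_one_iff₀ (norm_nonneg _)]
  nlinarith [sq_nonneg x.sigmaPlus]

lemma IsAdmissible.sigma1_le (h : x.IsAdmissible γ) : x.sigma1 ≤ 1 := by
  have := h.constraint
  have := h.omega_pos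
  nlinarith [sq_nonneg x.sigmaPlus, sq_nonneg ‖x.sigmaOne‖]

lemma IsAdmissible.norm_nCross_le (h : x.IsAdmissible γ) : ‖x.nCross‖ ≤ 1 := by
  have := h.sigma1_le
  unfold sigma1 at this
  rw [← sq_le_one_iff₀ (norm_nonneg _)]
  nlinarith [sq_nonneg ‖x.sigmaCross‖]

lemma IsAdmissible.norm_sigmaCross_le (h : x.IsAdmissible γ) : ‖x.sigmaCross‖ ≤ 1 := by
  have := h.sigma1_le
  unfold sigma1 at this
  rw [← sq_le_one_iff₀ (norm_nonneg _)]
  nlinarith [sq_nonneg ‖x.nCross‖]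

lemma IsAdmissible.norm_vC_le (h : x.IsAdmissible γ) : ‖x.vC‖ ≤ 1 := by
  have := h.Vsq_lt_one
  unfold Vsq at this
  rw [← sq_le_one_iff₀ (norm_nonneg _)]
  nlinarith [sq_nonneg x.vOne]

lemma IsAdmissible.abs_crossRe_le (h : x.IsAdmissible γ) : |x.crossRe| ≤ 1 := by
  refine (Complex.abs_re_le_norm _).trans ?_
  rw [norm_mul, Complex.norm_conj]
  exact mul_le_one₀ h.norm_sigmaCross_le (norm_nonneg _) h.norm_nCross_le

/-- The deceleration parameter, with the constraint used to eliminate its constant part. -/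
lemma IsAdmissible.two_q_sub (hγ : 2 / 3 < γ) (h : x.IsAdmissible γ) :
    2 * x.q γ + 2 - 3 * γ = (6 - 3 * γ) * (x.sigmaPlus ^ 2 + ‖x.sigmaOne‖ ^ 2)
      + (4 - 3 * γ) * (x.sigma1 + γ * x.omega * x.Vsq / x.Gplus γ)
      + 2 * (‖x.sigmaCross‖ ^ 2 - ‖x.nCross‖ ^ 2) := by
  have hG : x.Gplus γ ≠ 0 := by linarith [h.Gplus_ge hγ]
  have hc := h.constraint
  have hw : ((3 * γ - 2) + (2 - γ) * x.Vsq) / x.Gplus γ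
      = (3 * γ - 2) + γ * (4 - 3 * γ) * x.Vsq / x.Gplus γ := by
    field_simp
    unfold Gplus
    ring
  unfold q
  rw [hw]
  unfold SigmaSq
  unfold sigma1 at *
  linear_combination (3 * γ - 2) * hc

lemma IsAdmissible.q_nonneg (hγ : 2 / 3 < γ) (hγ' : γ ≤ 4 / 3) (h : x.IsAdmissible γ) :
    0 ≤ x.q γ := by
  have hG := h.Gplus_ge hγ
  have := x.Vsq_nonneg
  have := x.SigmaSq_nonneg
  have := h.omega_pos
  have : 0 ≤ (3 * γ - 2) + (2 - γ) * x.Vsq := by nlinarith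
  unfold q
  positivity

lemma IsAdmissible.q_le (hγ : 2 / 3 < γ) (hγ' : γ ≤ 4 / 3) (h : x.IsAdmissible γ) :
    x.q γ ≤ 3 := by
  have hG := h.Gplus_ge hγ
  have h0 := x.Vsq_nonneg
  have h1 := h.Vsq_lt_one
  have h2 : x.SigmaSq ≤ 1 := by
    have := h.hamiltonian
    have := h.omega_pos
    nlinarith [sq_nonneg ‖x.nCross‖]
  have h3 : ((3 * γ - 2) + (2 - γ) * x.Vsq) / x.Gplus γ ≤ 2 := by
    rw [div_le_iff₀ (by linarith)]
    unfold Gplus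
    nlinarith
  have h4 : ((3 * γ - 2) + (2 - γ) * x.Vsq) / x.Gplus γ * x.omega ≤ 2 := by
    nlinarith [h.omega_pos, h.omega_le]
  unfold q
  linarith

lemma IsAdmissible.restDensity_pos (hγ : 2 / 3 < γ) (h : x.IsAdmissible γ) :
    0 < x.restDensity γ := by
  have hG := h.Gplus_ge hγ
  have := h.omega_pos
  have : 0 < 1 - x.Vsq := by linarith [h.Vsq_lt_one]
  unfold restDensity
  positivity

/-- As 0 < 1 - V² ≤ 1, an exponent below 1 only increases the power, while G₊ - γV² = 1 - V². This
lower bound on Q turns the terms with factor 4-3γ into a multiple of 1-Q. -/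
lemma IsAdmissible.one_sub_restDensity_le (hγ : 2 / 3 < γ) (h : x.IsAdmissible γ) :
    1 - x.restDensity γ ≤ 1 - x.omega + γ * x.omega * x.Vsq / x.Gplus γ := by
  have hG := h.Gplus_ge hγ
  have hp : 0 < 1 - x.Vsq := by linarith [h.Vsq_lt_one]
  have h1 : 1 - x.Vsq ≤ (1 - x.Vsq) ^ (1 - γ / 2) := by
    conv_lhs => rw [← Real.rpow_one (1 - x.Vsq)]
    exact Real.rpow_le_rpow_of_exponent_ge hp (by linarith [x.Vsq_nonneg]) (by linarith)
  have h2 : x.omega - γ * x.omega * x.Vsq / x.Gplus γ = x.omega * (1 - x.Vsq) / x.Gplus γ := by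
    have : x.Gplus γ ≠ 0 := by linarith
    field_simp
    unfold Gplus
    ring
  have h3 : x.omega * (1 - x.Vsq) / x.Gplus γ ≤ x.restDensity γ := by
    unfold restDensity
    have := h.omega_pos.le
    gcongr
  linarith

/-- Bernoulli's inequality for an exponent in [0, 1], with G₊ - (γ/2)V² = 1 - (1-γ/2)V². It makes
1-Q control both the tilt and 1-Ω, hence the shear and N_×. -/
lemma IsAdmissible.le_one_sub_restDensity (hγ : 2 / 3 < γ) (hγ' : γ ≤ 4 / 3)
    (h : x.IsAdmissible γ) :
    1 - x.omega + γ / 2 * x.omega * x.Vsq / x.Gplus γ ≤ 1 - x.restDensity γ := by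
  have hG := h.Gplus_ge hγ
  have h1 : (1 - x.Vsq) ^ (1 - γ / 2) ≤ 1 - (1 - γ / 2) * x.Vsq := by
    have := rpow_one_add_le_one_add_mul_self (s := -x.Vsq) (by linarith [h.Vsq_lt_one])
      (p := 1 - γ / 2) (by linarith) (by linarith)
    rw [← sub_eq_add_neg] at this
    linarith
  have h2 : x.omega - γ / 2 * x.omega * x.Vsq / x.Gplus γ
      = x.omega * (1 - (1 - γ / 2) * x.Vsq) / x.Gplus γ := by
    have : x.Gplus γ ≠ 0 := by linarith
    field_simp
    unfold Gplus
    ring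
  have h3 : x.restDensity γ ≤ x.omega * (1 - (1 - γ / 2) * x.Vsq) / x.Gplus γ := by
    unfold restDensity
    have := h.omega_pos.le
    gcongr
  linarith

lemma IsAdmissible.restDensity_le_one (hγ : 2 / 3 < γ) (hγ' : γ ≤ 4 / 3)
    (h : x.IsAdmissible γ) : x.restDensity γ ≤ 1 := by
  have h1 := h.le_one_sub_restDensity hγ hγ'
  have hG := h.Gplus_ge hγ
  have h2 : 0 ≤ γ / 2 * x.omega * x.Vsq / x.Gplus γ := by
    have := h.omega_pos
    have := x.Vsq_nonneg
    positivity
  linarith [h.omega_le]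

end State

/-! ### Particle conservation along solutions. -/

section Evolution

variable {γ τ : ℝ} {X : ℝ → State}

lemma _root_.HasDerivAt.complex_re {f : ℝ → ℂ} {f' : ℂ} {t : ℝ} (h : HasDerivAt f f' t) :
    HasDerivAt (fun s => (f s).re) f'.re t :=
  Complex.reCLM.hasFDerivAt.comp_hasDerivAt t h

lemma _root_.HasDerivAt.complex_im {f : ℝ → ℂ} {f' : ℂ} {t : ℝ} (h : HasDerivAt f f' t) :
    HasDerivAt (fun s => (f s).im) f'.im t :=
  Complex.imCLM.hasFDerivAt.comp_hasDerivAt t h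

lemma EvolvesAt.hasDerivAt_Vsq (h : EvolvesAt γ X τ) :
    HasDerivAt (fun t => (X t).Vsq) (2 * ((X τ).T γ * (X τ).Vsq - (X τ).VsqS)) τ := by
  have h1 := (h.vOne.pow 2).add ((h.vC.complex_re.pow 2).add (h.vC.complex_im.pow 2))
  refine (h1.congr_deriv ?_).congr_of_eventuallyEq (.of_forall fun t => ?_)
  rotate_left
  · simp only [State.Vsq, Complex.sq_norm, Complex.normSq_apply, Pi.add_apply, Pi.pow_apply]
    ring
  · simp only [State.Vsq, State.VsqS, Complex.sq_norm, Complex.normSq_apply]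
    simp [pow_two]
    ring

/-- Conservation of the particle number. -/
lemma EvolvesAt.hasDerivAt_log_restDensity (hγ : 2 / 3 < γ) (hγ' : γ ≤ 4 / 3)
    (ha : ∀ᶠ t in 𝓝 τ, (X t).IsAdmissible γ) (h : EvolvesAt γ X τ) :
    HasDerivAt (fun t => Real.log ((X t).restDensity γ)) (2 * (X τ).q γ + 2 - 3 * γ) τ := by
  have h0 := ha.self_of_nhds
  have hG := h0.Gplus_ge hγ
  have hx0 := (X τ).Vsq_nonneg
  have hx : 0 < 1 - (X τ).Vsq := by linarith [h0.Vsq_lt_one]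
  have hd : 0 < 1 - (γ - 1) * (X τ).Vsq := by nlinarith
  have hΩ := h0.omega_pos
  have hV := h.hasDerivAt_Vsq
  have h1 : HasDerivAt (fun t => Real.log (X t).omega
      + (1 - γ / 2) * Real.log (1 - (X t).Vsq) - Real.log (1 + (γ - 1) * (X t).Vsq)) _ τ :=
    ((h.omega.log hΩ.ne').add (((hV.const_sub 1).log hx.ne').const_mul (1 - γ / 2))).sub
      (((hV.const_mul (γ - 1)).const_add 1).log (by unfold State.Gplus at hG; linarith))
  have h2 := h1.congr_of_eventuallyEq (f₁ := fun t => Real.log ((X t).restDensity γ)) (by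
    filter_upwards [ha] with t ht
    have hG' := ht.Gplus_ge hγ
    have hx' : 0 < 1 - (X t).Vsq := by linarith [ht.Vsq_lt_one]
    have hΩ' := ht.omega_pos
    unfold State.restDensity
    rw [Real.log_div (by positivity) (by positivity), Real.log_mul (by positivity) (by positivity),
      Real.log_rpow hx']
    rfl)
  -- The anisotropic term V²𝒮 cancels between Ω' and (V²)', so only q remains.
  refine h2.congr_deriv ?_
  have e : (X τ).Gplus γ = 1 + (γ - 1) * (X τ).Vsq := rfl
  rw [e] at hG ⊢
  unfold State.T
  generalize (X τ).Vsq = x at *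
  generalize (X τ).VsqS = s at *
  generalize (X τ).q γ = q at *
  generalize (X τ).omega = Ω at *
  have hG0 : 1 + (γ - 1) * x ≠ 0 := by linarith
  field_simp
  ring

/-! ### Averaging of the oscillating term. -/

/-- The part of the derivative of `Re (Σ_×^* N_×)` that is not proportional to `N̄`. -/
noncomputable def crossRemainder (γ : ℝ) (x : State) : ℝ :=
  (2 * x.q γ - 2 + 2 * x.sigmaPlus) * x.crossRe + √3 * (conj x.sigmaOne ^ 2 * x.nCross).re
    + √3 * γ * x.omega / (2 * x.Gplus γ) * (conj x.vC ^ 2 * x.nCross).re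

lemma abs_crossRemainder_le {x : State} (hγ : 2 / 3 < γ) (hγ' : γ ≤ 4 / 3)
    (h : x.IsAdmissible γ) : |crossRemainder γ x| ≤ 12 := by
  have hG := h.Gplus_ge hγ
  have hq := h.q_le hγ hγ'
  have hq0 := h.q_nonneg hγ hγ'
  have hs := abs_le.1 h.abs_sigmaPlus_le
  have hΩ := h.omega_pos
  have hΩ1 := h.omega_le
  have h3 : √3 ≤ 2 := by rw [Real.sqrt_le_left (by norm_num)]; norm_num
  have key : ∀ z : ℂ, ‖z‖ ≤ 1 → |(conj z ^ 2 * x.nCross).re| ≤ 1 := by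
    intro z hz
    refine (Complex.abs_re_le_norm _).trans ?_
    rw [norm_mul, norm_pow, Complex.norm_conj]
    exact mul_le_one₀ (pow_le_one₀ (norm_nonneg _) hz) (norm_nonneg _) h.norm_nCross_le
  have b1 : |(2 * x.q γ - 2 + 2 * x.sigmaPlus) * x.crossRe| ≤ 8 := by
    rw [abs_mul]
    have : |2 * x.q γ - 2 + 2 * x.sigmaPlus| ≤ 8 := by rw [abs_le]; constructor <;> linarith
    nlinarith [h.abs_crossRe_le, abs_nonneg x.crossRe]
  have b2 : |√3 * (conj x.sigmaOne ^ 2 * x.nCross).re| ≤ 2 := by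
    rw [abs_mul, abs_of_nonneg (Real.sqrt_nonneg 3)]
    nlinarith [key _ h.norm_sigmaOne_le, abs_nonneg (conj x.sigmaOne ^ 2 * x.nCross).re,
      Real.sqrt_nonneg 3]
  have b3 : |√3 * γ * x.omega / (2 * x.Gplus γ) * (conj x.vC ^ 2 * x.nCross).re| ≤ 2 := by
    have hc : √3 * γ * x.omega / (2 * x.Gplus γ) ≤ 2 := by
      rw [div_le_iff₀ (by linarith)]
      have h4 : √3 * γ ≤ 2 * (4 / 3) := by gcongr
      have : √3 * γ * x.omega ≤ 2 * (4 / 3) * 1 := by gcongr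
      linarith
    have hc0 : 0 ≤ √3 * γ * x.omega / (2 * x.Gplus γ) := by positivity
    rw [abs_mul, abs_of_nonneg hc0]
    nlinarith [key _ h.norm_vC_le, abs_nonneg (conj x.vC ^ 2 * x.nCross).re]
  unfold crossRemainder
  refine (abs_add_three _ _ _).trans ?_
  linarith

lemma EvolvesAt.hasDerivAt_crossRe (h : EvolvesAt γ X τ) :
    HasDerivAt (fun t => (X t).crossRe)
      (2 * √3 * (X τ).nBar * (‖(X τ).sigmaCross‖ ^ 2 - ‖(X τ).nCross‖ ^ 2)
        + crossRemainder γ (X τ)) τ := by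
  have h1 := (h.sigmaCross.complex_re.mul h.nCross.complex_re).add
    (h.sigmaCross.complex_im.mul h.nCross.complex_im)
  refine (h1.congr_deriv ?_).congr_of_eventuallyEq (.of_forall fun t => ?_)
  rotate_left
  · simp [State.crossRe]
  · unfold crossRemainder
    generalize √3 * γ * (X τ).omega / (2 * (X τ).Gplus γ) = κ
    simp only [State.crossRe, Complex.sq_norm, Complex.normSq_apply]
    simp [pow_two]
    ring

/-- The averaging correction `Re (Σ_×^* N_×) / (√3 N̄)`. -/
noncomputable def correction (x : State) : ℝ := x.crossRe / (√3 * x.nBar)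

lemma State.IsAdmissible.abs_correction_le {x : State} (h : x.IsAdmissible γ)
    (hN : 1 ≤ x.nBar) : |correction x| ≤ 1 / x.nBar := by
  have h3 : 1 ≤ √3 := by rw [Real.one_le_sqrt]; norm_num
  unfold correction
  rw [abs_div, abs_of_nonneg (by positivity : 0 ≤ √3 * x.nBar)]
  have := h.abs_crossRe_le
  gcongr
  nlinarith

/-- The correction generates `2 (|Σ_×|² - |N_×|²)` up to an error of order `1 / N̄`. -/
lemma EvolvesAt.hasDerivAt_correction (hγ : 2 / 3 < γ) (hγ' : γ ≤ 4 / 3)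
    (ha : (X τ).IsAdmissible γ) (hN : 1 ≤ (X τ).nBar) (h : EvolvesAt γ X τ) :
    ∃ e : ℝ, |e| ≤ 21 / (X τ).nBar ∧ HasDerivAt (fun t => correction (X t))
      (2 * (‖(X τ).sigmaCross‖ ^ 2 - ‖(X τ).nCross‖ ^ 2) + e) τ := by
  have hN0 : 0 < (X τ).nBar := by linarith
  have h3 : 1 ≤ √3 := by rw [Real.one_le_sqrt]; norm_num
  have h3' : √3 ≤ 2 := by rw [Real.sqrt_le_left (by norm_num)]; norm_num
  have hd := h.hasDerivAt_crossRe.div (h.nBar.const_mul √3) (by positivity)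
  have hA := ha.abs_crossRe_le
  have hR := abs_crossRemainder_le hγ hγ' ha
  have hq := ha.q_le hγ hγ'
  have hq0 := ha.q_nonneg hγ hγ'
  have hs := abs_le.1 ha.abs_sigmaPlus_le
  refine ⟨(crossRemainder γ (X τ) - (X τ).crossRe * ((X τ).q γ + 2 * (X τ).sigmaPlus)
    - 2 * √3 * (X τ).crossRe ^ 2 / (X τ).nBar) / (√3 * (X τ).nBar), ?_, ?_⟩
  -- The 21 is 12 + 5 + 4: the bound on `crossRemainder` and the two contributions of N̄'/N̄. The
  -- factor √3 ≥ 1 in the denominator is dropped.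
  · rw [abs_div, abs_of_nonneg (by positivity : 0 ≤ √3 * (X τ).nBar)]
    have b1 : |(X τ).crossRe * ((X τ).q γ + 2 * (X τ).sigmaPlus)| ≤ 5 := by
      rw [abs_mul]
      have : |(X τ).q γ + 2 * (X τ).sigmaPlus| ≤ 5 := by rw [abs_le]; constructor <;> linarith
      nlinarith [abs_nonneg (X τ).crossRe, abs_nonneg ((X τ).q γ + 2 * (X τ).sigmaPlus)]
    have b2 : |2 * √3 * (X τ).crossRe ^ 2 / (X τ).nBar| ≤ 4 := by
      rw [abs_of_nonneg (by positivity), div_le_iff₀ hN0]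
      have : (X τ).crossRe ^ 2 ≤ 1 := (sq_le_one_iff_abs_le_one _).2 hA
      nlinarith [sq_nonneg (X τ).crossRe]
    have b3 := abs_sub (crossRemainder γ (X τ) - (X τ).crossRe * ((X τ).q γ
      + 2 * (X τ).sigmaPlus)) (2 * √3 * (X τ).crossRe ^ 2 / (X τ).nBar)
    have b4 := abs_sub (crossRemainder γ (X τ)) ((X τ).crossRe * ((X τ).q γ
      + 2 * (X τ).sigmaPlus))
    gcongr
    · linarith
    · nlinarith
  · refine hd.congr_deriv ?_
    have e : (conj (X τ).sigmaCross * (X τ).nCross).re = (X τ).crossRe := rfl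
    rw [e]
    field_simp
    ring

end Evolution

end BianchiVII0

/-! ### Monotone convergence, a Gronwall estimate and a Barbalat-type lemma. -/

section RealAnalysis

open Set Filter

lemma monotoneOn_Ici_of_hasDerivAt_nonneg {f f' : ℝ → ℝ} {a : ℝ}
    (h : ∀ t ≥ a, HasDerivAt f (f' t) t) (h0 : ∀ t ≥ a, 0 ≤ f' t) : MonotoneOn f (Ici a) := by
  refine monotoneOn_of_deriv_nonneg (convex_Ici a)
    (fun t ht => (h t ht).continuousAt.continuousWithinAt) ?_ ?_ <;>
    intro t ht <;> rw [interior_Ici] at ht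
  · exact (h t ht.le).differentiableAt.differentiableWithinAt
  · rw [(h t ht.le).deriv]
    exact h0 t ht.le

lemma exists_tendsto_of_monotoneOn_Ici {f : ℝ → ℝ} {a b : ℝ} (h : MonotoneOn f (Ici a))
    (hb : ∀ t ≥ a, f t ≤ b) : ∃ l, Tendsto f atTop (𝓝 l) := by
  have hm : Monotone fun t => f (max t a) := fun s t hst =>
    h (mem_Ici.2 (le_max_right _ _)) (mem_Ici.2 (le_max_right _ _)) (max_le_max_right a hst)
  refine ⟨_, (tendsto_atTop_ciSup hm ⟨b, ?_⟩).congr' ?_⟩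
  · rintro _ ⟨t, rfl⟩
    exact hb _ (le_max_right _ _)
  · filter_upwards [eventually_ge_atTop a] with t ht
    simp only [max_eq_left ht]

/-- With the integrating factor, exp(kt)(b - y) is nondecreasing, so y - b is at most a constant
times exp(-kt). -/
lemma eventually_le_add_of_hasDerivAt_le {y y' : ℝ → ℝ} {a b k ε : ℝ} (hk : 0 < k) (hε : 0 < ε)
    (h : ∀ t ≥ a, HasDerivAt y (y' t) t) (h' : ∀ t ≥ a, y' t ≤ -k * y t + k * b) :
    ∀ᶠ t in atTop, y t ≤ b + ε := by
  have hd : ∀ t ≥ a, HasDerivAt (fun s => Real.exp (k * s) * (b - y s))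
      (Real.exp (k * t) * (k * (b - y t) - y' t)) t := fun t ht =>
    ((((hasDerivAt_id t).const_mul k).exp).mul ((h t ht).const_sub b)).congr_deriv (by
      simp only [id]; ring)
  have hm := monotoneOn_Ici_of_hasDerivAt_nonneg hd fun t ht =>
    mul_nonneg (Real.exp_pos _).le (by linarith [h' t ht])
  have hlim : Tendsto (fun t => Real.exp (-(k * t)) * (Real.exp (k * a) * (b - y a))) atTop
      (𝓝 (0 * (Real.exp (k * a) * (b - y a)))) :=
    (Real.tendsto_exp_neg_atTop_nhds_zero.comp (tendsto_id.const_mul_atTop hk)).mul_const _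
  rw [zero_mul] at hlim
  filter_upwards [eventually_ge_atTop a, hlim.eventually (lt_mem_nhds (neg_lt_zero.2 hε))]
    with t ht h1
  have h2 := mul_le_mul_of_nonneg_left (hm self_mem_Ici ht ht) (Real.exp_pos (-(k * t))).le
  simp only [← mul_assoc, ← Real.exp_add, neg_add_cancel, Real.exp_zero, one_mul] at h1 h2
  linarith

/-- A function with bounded derivative is controlled by a bounded function that increases at least
at the rate of its square. -/
lemma tendsto_zero_of_sq_le_deriv {f f' H H' : ℝ → ℝ} {a b B : ℝ}
    (hf : ∀ t ≥ a, HasDerivAt f (f' t) t) (hB : ∀ t ≥ a, |f' t| ≤ B) (hf1 : ∀ t ≥ a, |f t| ≤ 1)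
    (hH : ∀ t ≥ a, HasDerivAt H (H' t) t) (hfH : ∀ t ≥ a, f t ^ 2 ≤ H' t)
    (hb : ∀ t ≥ a, H t ≤ b) : Tendsto f atTop (𝓝 0) := by
  have hB0 : 0 ≤ B := (abs_nonneg _).trans (hB a le_rfl)
  -- Chosen so that |(k f³)'| ≤ 3kB f² ≤ f² ≤ H'. Then H and H + k f³ are both monotone and bounded
  -- above, so f³ converges as their difference over k.
  set k : ℝ := 1 / (3 * (B + 1)) with hk
  have hk0 : 0 < k := by positivity
  have hkB : 3 * k * B ≤ 1 := by
    rw [hk]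
    have : 3 * (1 / (3 * (B + 1))) * B = B / (B + 1) := by field_simp
    rw [this, div_le_one (by linarith)]
    linarith
  have hcube : ∀ t ≥ a, HasDerivAt (fun s => H s + k * f s ^ 3)
      (H' t + k * (3 * f t ^ 2 * f' t)) t := fun t ht =>
    ((hH t ht).add (((hf t ht).pow 3).const_mul k)).congr_deriv (by norm_num)
  obtain ⟨l, hl⟩ := exists_tendsto_of_monotoneOn_Ici (monotoneOn_Ici_of_hasDerivAt_nonneg hH
    fun t ht => (sq_nonneg _).trans (hfH t ht)) hb
  obtain ⟨m, hm⟩ := exists_tendsto_of_monotoneOn_Ici (b := b + k)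
    (monotoneOn_Ici_of_hasDerivAt_nonneg hcube fun t ht => by
      have h1 := (abs_le.1 (hB t ht)).1
      have h2 : 0 ≤ k * 3 * f t ^ 2 * (f' t + B) := mul_nonneg (by positivity) (by linarith)
      nlinarith [hfH t ht, sq_nonneg (f t)]) fun t ht => by
      have h1 : f t ^ 3 ≤ 1 := (le_abs_self _).trans (by
        rw [abs_pow]; exact pow_le_one₀ (abs_nonneg _) (hf1 t ht))
      nlinarith [hb t ht]
  have h3 : Tendsto (fun t => |f t| ^ 3) atTop (𝓝 |(m - l) / k|) := by
    refine (((hm.sub hl).div_const k).abs).congr fun t => ?_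
    rw [add_sub_cancel_left, mul_div_cancel_left₀ _ hk0.ne', abs_pow]
  by_cases h0 : m - l = 0
  · rw [h0, zero_div, abs_zero] at h3
    rw [tendsto_zero_iff_abs_tendsto_zero]
    have h4 := h3.rpow_const (p := 1 / 3) (Or.inr (by norm_num))
    rw [Real.zero_rpow (by norm_num)] at h4
    refine h4.congr fun t => ?_
    rw [← Real.rpow_natCast, ← Real.rpow_mul (abs_nonneg _)]
    norm_num
  · exfalso
    set c := |(m - l) / k| with hc
    have hc0 : 0 < c := abs_pos.2 (div_ne_zero h0 hk0.ne')
    obtain ⟨s, hs⟩ := eventually_atTop.1 (h3.eventually (lt_mem_nhds (half_lt_self hc0)))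
    -- A nonzero limit of f³ keeps H' ≥ f² ≥ |f|³ away from 0, so H would grow linearly.
    have hgrow : ∀ t ≥ max s a, c / 2 ≤ H' t := fun t ht => by
      have h5 := hs t ((le_max_left _ _).trans ht)
      have h6 := hfH t ((le_max_right _ _).trans ht)
      have h7 := hf1 t ((le_max_right _ _).trans ht)
      have h8 : |f t| ^ 3 ≤ |f t| ^ 2 := pow_le_pow_of_le_one (abs_nonneg _) h7 (by norm_num)
      rw [sq_abs] at h8
      linarith
    have hmono := monotoneOn_Ici_of_hasDerivAt_nonneg (f := fun t => H t - c / 2 * t)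
      (f' := fun t => H' t - c / 2) (a := max s a) (fun t ht =>
        ((hH t ((le_max_right _ _).trans ht)).sub
          ((hasDerivAt_id t).const_mul (c / 2))).congr_deriv (by simp))
      fun t ht => by linarith [hgrow t ht]
    obtain ⟨t, ht, ht'⟩ := ((eventually_ge_atTop (max s a)).and
      ((tendsto_id.const_mul_atTop (half_pos hc0)).eventually_gt_atTop
        (b - (H (max s a) - c / 2 * max s a)))).exists
    have h9 := hmono self_mem_Ici ht ht
    have h10 := hb t ((le_max_right _ _).trans ht)
    simp only [id] at ht' h9
    linarith

end RealAnalysis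

/-! ### The averaged density along a model, and the case γ < 4/3. -/

namespace BianchiVII0

open Filter

section Model

variable {γ τ₀ τ : ℝ} {X : ℝ → State}

/-- The logarithm of the normalised rest density, with its oscillation removed to leading order. -/
noncomputable def averagedLogDensity (γ : ℝ) (x : State) : ℝ :=
  Real.log (x.restDensity γ) - correction x

lemma State.IsAdmissible.averagedLogDensity_le {x : State} (hγ : 2 / 3 < γ) (hγ' : γ ≤ 4 / 3)
    (h : x.IsAdmissible γ) : averagedLogDensity γ x ≤ -correction x := by
  have := Real.log_nonpos (h.restDensity_pos hγ).le (h.restDensity_le_one hγ hγ')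
  unfold averagedLogDensity
  linarith

lemma IsModel.hasDerivAt_averagedLogDensity (hγ : 2 / 3 < γ) (hγ' : γ ≤ 4 / 3)
    (hX : IsModel γ τ₀ X) (hτ : τ₀ < τ) (hN : 1 ≤ (X τ).nBar) :
    ∃ e : ℝ, |e| ≤ 21 / (X τ).nBar ∧
      HasDerivAt (fun t => correction (X t))
        (2 * (‖(X τ).sigmaCross‖ ^ 2 - ‖(X τ).nCross‖ ^ 2) + e) τ ∧
      HasDerivAt (fun t => averagedLogDensity γ (X t))
        ((6 - 3 * γ) * ((X τ).sigmaPlus ^ 2 + ‖(X τ).sigmaOne‖ ^ 2)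
          + (4 - 3 * γ) * ((X τ).sigma1 + γ * (X τ).omega * (X τ).Vsq / (X τ).Gplus γ) - e) τ := by
  obtain ⟨ha, he⟩ := hX τ hτ
  obtain ⟨e, he1, he2⟩ := he.hasDerivAt_correction hγ hγ' ha hN
  have hlog := he.hasDerivAt_log_restDensity hγ hγ'
    ((eventually_gt_nhds hτ).mono fun t ht => (hX t ht).1)
  refine ⟨e, he1, he2, (hlog.sub he2).congr_deriv ?_⟩
  rw [ha.two_q_sub hγ]
  ring

lemma IsModel.tendsto_correction (hX : IsModel γ τ₀ X)
    (hN : Tendsto (fun τ => (X τ).nBar) atTop atTop) :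
    Tendsto (fun τ => correction (X τ)) atTop (𝓝 0) := by
  refine squeeze_zero_norm' ?_ ((tendsto_const_nhds (x := (1 : ℝ))).div_atTop hN)
  filter_upwards [hN.eventually_ge_atTop 1, eventually_gt_atTop τ₀] with t h1 ht
  exact (hX t ht).1.abs_correction_le h1

/-- For y = exp(-`averagedLogDensity`), the product yQ is exp(`correction`), close to 1. The growth
estimate for log Q thereby becomes a linear differential inequality driving y below 1 + 2ε. -/
lemma IsModel.tendsto_restDensity (hγ : 2 / 3 < γ) (hγ' : γ < 4 / 3) (hX : IsModel γ τ₀ X)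
    (hN : Tendsto (fun τ => (X τ).nBar) atTop atTop) :
    Tendsto (fun τ => (X τ).restDensity γ) atTop (𝓝 1) := by
  have key : ∀ ε : ℝ, 0 < ε → ε ≤ 1 → ∀ᶠ t in atTop, 1 - 3 * ε ≤ (X t).restDensity γ := by
    intro ε hε hε1
    have hc : 0 < 4 - 3 * γ := by linarith
    have hexp : Tendsto (fun t => Real.exp (correction (X t))) atTop (𝓝 1) := by
      simpa using (hX.tendsto_correction hN).rexp
    have hinv : Tendsto (fun t => 21 / (X t).nBar) atTop (𝓝 0) :=
      tendsto_const_nhds.div_atTop hN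
    have hev : ∀ᶠ t in atTop, τ₀ < t ∧ 1 ≤ (X t).nBar
        ∧ Real.exp (correction (X t)) ≤ 1 + ε / 2 ∧ 21 / (X t).nBar ≤ (4 - 3 * γ) * (ε / 4) := by
      filter_upwards [eventually_gt_atTop τ₀, hN.eventually_ge_atTop 1,
        hexp.eventually_le_const (by linarith : 1 < 1 + ε / 2),
        hinv.eventually_le_const (by positivity : 0 < (4 - 3 * γ) * (ε / 4))] with t h1 h2 h3 h4
      exact ⟨h1, h2, h3, h4⟩
    obtain ⟨a, ha⟩ := eventually_atTop.1 hev
    have hmul : ∀ t > τ₀, Real.exp (-averagedLogDensity γ (X t)) * (X t).restDensity γ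
        = Real.exp (correction (X t)) := by
      intro t ht
      conv_lhs => rw [← Real.exp_log ((hX t ht).1.restDensity_pos hγ)]
      rw [← Real.exp_add]
      congr 1
      unfold averagedLogDensity
      ring
    have hder : ∀ t ≥ a, ∃ y' : ℝ,
        HasDerivAt (fun s => Real.exp (-averagedLogDensity γ (X s))) y' t ∧
        y' ≤ -((4 - 3 * γ) * (1 - ε / 4)) * Real.exp (-averagedLogDensity γ (X t))
          + ((4 - 3 * γ) * (1 - ε / 4)) * (1 + ε) := by
      intro t ht
      obtain ⟨h1, h2, h3, h4⟩ := ha t ht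
      obtain ⟨e, he, -, hd⟩ := hX.hasDerivAt_averagedLogDensity hγ hγ'.le h1 h2
      refine ⟨_, hd.neg.exp, ?_⟩
      have had := (hX t h1).1
      have hy := Real.exp_pos (-averagedLogDensity γ (X t))
      have hQ := had.one_sub_restDensity_le hγ
      have hcon := had.constraint
      have hm := hmul t h1
      set y := Real.exp (-averagedLogDensity γ (X t))
      set Q := (X t).restDensity γ
      set w := γ * (X t).omega * (X t).Vsq / (X t).Gplus γ
      set r := (X t).sigmaPlus ^ 2 + ‖(X t).sigmaOne‖ ^ 2
      have hr : 0 ≤ r := by positivity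
      have h5 : (4 - 3 * γ) * (1 - Q) ≤ (4 - 3 * γ) * (r + (X t).sigma1 + w) :=
        mul_le_mul_of_nonneg_left (by linarith) hc.le
      have h6 : (4 - 3 * γ) * (1 - Q) - (4 - 3 * γ) * (ε / 4)
          ≤ (6 - 3 * γ) * r + (4 - 3 * γ) * ((X t).sigma1 + w) - e := by
        have := (le_abs_self e).trans (he.trans h4)
        linarith
      have h7 := mul_le_mul_of_nonneg_left h6 hy.le
      -- Since ε ≤ 1, 1 + ε/2 ≤ (1 - ε/4)(1 + ε); this puts the inequality in the form -ky + kb with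
      -- b = 1 + ε.
      have h8 : (4 - 3 * γ) * (y * Q) ≤ (4 - 3 * γ) * ((1 - ε / 4) * (1 + ε)) := by
        rw [hm]
        refine mul_le_mul_of_nonneg_left (h3.trans ?_) hc.le
        nlinarith
      change y * _ ≤ _
      linarith
    choose! y' hy' hle using hder
    have hk : 0 < (4 - 3 * γ) * (1 - ε / 4) := mul_pos hc (by linarith)
    filter_upwards [eventually_le_add_of_hasDerivAt_le hk hε hy' hle, eventually_gt_atTop τ₀,
      hexp.eventually_const_le (by linarith : 1 - ε < 1)] with t h1 h2 h3
    have had := (hX t h2).1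
    rw [← hmul t h2] at h3
    -- From 1 - ε ≤ yQ ≤ (1 + 2ε)Q and Q ≤ 1.
    nlinarith [had.restDensity_pos hγ, had.restDensity_le_one hγ hγ'.le]
  rw [tendsto_order]
  constructor
  · intro b hb
    filter_upwards [key (min 1 ((1 - b) / 4)) (lt_min one_pos (by linarith)) (min_le_left _ _)]
      with t ht
    linarith [min_le_right 1 ((1 - b) / 4)]
  · intro b hb
    filter_upwards [eventually_gt_atTop τ₀] with t ht
    exact ((hX t ht).1.restDensity_le_one hγ hγ'.le).trans_lt hb

theorem IsModel.tendsto_isotropic (hγ : 2 / 3 < γ) (hγ' : γ < 4 / 3) (hX : IsModel γ τ₀ X)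
    (hN : Tendsto (fun τ => (X τ).nBar) atTop atTop) :
    Tendsto (fun τ => ((X τ).sigmaPlus, (X τ).V, (X τ).sigma1)) atTop
      (𝓝 ((0 : ℝ), (0 : ℝ), (0 : ℝ))) := by
  have hQ := hX.tendsto_restDensity hγ hγ' hN
  have hQ0 : Tendsto (fun τ => 8 * (1 - (X τ).restDensity γ)) atTop (𝓝 0) := by
    simpa using (hQ.const_sub 1).const_mul 8
  have hbound : ∀ᶠ t in atTop, (X t).sigmaPlus ^ 2 ≤ 8 * (1 - (X t).restDensity γ) ∧
      (X t).Vsq ≤ 8 * (1 - (X t).restDensity γ) ∧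
      (X t).sigma1 ≤ 8 * (1 - (X t).restDensity γ) := by
    filter_upwards [eventually_gt_atTop τ₀,
      hQ.eventually_const_le (by norm_num : (1 / 2 : ℝ) < 1)] with t ht hhalf
    have had := (hX t ht).1
    have h1 := had.le_one_sub_restDensity hγ hγ'.le
    have h2 := had.restDensity_le_one hγ hγ'.le
    have h3 := had.constraint
    have h4 := (X t).sigma1_nonneg
    have h5 := (X t).Vsq_nonneg
    have hG := had.Gplus_ge hγ
    have hG' := had.Gplus_le hγ'.le
    have hΩ := had.omega_pos
    have hw : 0 ≤ γ / 2 * (X t).omega * (X t).Vsq / (X t).Gplus γ := by positivity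
    -- The 1/8 is (1/3)(1/2)/(4/3), from γ/2 ≥ 1/3, Ω ≥ Q ≥ 1/2 and G₊ ≤ 4/3.
    have hw' : (X t).Vsq / 8 ≤ γ / 2 * (X t).omega * (X t).Vsq / (X t).Gplus γ := by
      rw [le_div_iff₀ (by linarith)]
      have hγ2 : 1 / 3 ≤ γ / 2 := by linarith
      have : 1 / 3 * (1 / 2) * (X t).Vsq ≤ γ / 2 * (X t).omega * (X t).Vsq := by
        gcongr
        linarith
      nlinarith
    have h6 := sq_nonneg (X t).sigmaPlus
    have h7 := sq_nonneg ‖(X t).sigmaOne‖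
    refine ⟨?_, ?_, ?_⟩ <;> linarith [had.omega_le]
  refine Tendsto.prodMk_nhds ?_ (Tendsto.prodMk_nhds ?_ ?_)
  · have h : Tendsto (fun t => (X t).sigmaPlus ^ 2) atTop (𝓝 0) :=
      squeeze_zero' (.of_forall fun t => sq_nonneg _) (hbound.mono fun t ht => ht.1) hQ0
    have h' := h.sqrt
    simp only [Real.sqrt_sq_eq_abs, Real.sqrt_zero] at h'
    exact (tendsto_zero_iff_abs_tendsto_zero _).2 h'
  · have h : Tendsto (fun t => (X t).Vsq) atTop (𝓝 0) :=
      squeeze_zero' (.of_forall fun t => State.Vsq_nonneg _) (hbound.mono fun t ht => ht.2.1) hQ0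
    have h' := h.sqrt
    rwa [Real.sqrt_zero] at h'
  · exact squeeze_zero' (.of_forall fun t => State.sigma1_nonneg _)
      (hbound.mono fun t ht => ht.2.2) hQ0

/-! ### The radiation case γ = 4/3. -/

/-- For radiation `N̄` grows at least exponentially. -/
lemma IsModel.exists_inv_nBar_le (hX : IsModel (4 / 3) τ₀ X)
    (hN : Tendsto (fun τ => (X τ).nBar) atTop atTop) :
    ∃ K : ℝ, ∀ᶠ t in atTop, 1 / (X t).nBar ≤ K * Real.exp (-(1 / 4) * t) := by
  obtain ⟨a, ha⟩ := eventually_atTop.1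
    ((eventually_gt_atTop τ₀).and (hN.eventually_ge_atTop 100))
  -- Both q in (log N̄)' and the derivative of (log Q)/2 contain |Σ_×|² - |N_×|²; subtracting
  -- `correction` in total cancels the two copies.
  have hder : ∀ t ≥ a, ∃ d : ℝ, HasDerivAt (fun s => Real.log (X s).nBar - correction (X s) / 2
      + averagedLogDensity (4 / 3) (X s) / 2 - 1 / 4 * s) d t ∧ 0 ≤ d := by
    intro t ht
    obtain ⟨h1, h2⟩ := ha t ht
    obtain ⟨had, hev⟩ := hX t h1
    obtain ⟨e, he, hd1, hd2⟩ := hX.hasDerivAt_averagedLogDensity (by norm_num) le_rfl h1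
      (by linarith)
    have hN0 : 0 < (X t).nBar := by linarith
    refine ⟨_, (((hev.nBar.log hN0.ne').sub (hd1.div_const 2)).add (hd2.div_const 2)).sub
      ((hasDerivAt_id t).const_mul (1 / 4)), ?_⟩
    have hq := had.two_q_sub (by norm_num)
    have hA := had.abs_crossRe_le
    have h3 : √3 ≤ 2 := by rw [Real.sqrt_le_left (by norm_num)]; norm_num
    have b1 : |2 * √3 * (X t).crossRe| ≤ 4 := by
      rw [abs_mul, abs_of_nonneg (by positivity)]
      nlinarith [abs_nonneg (X t).crossRe]
    have b2 : (((X t).q (4 / 3) + 2 * (X t).sigmaPlus) * (X t).nBar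
        + 2 * √3 * (conj (X t).sigmaCross * (X t).nCross).re) / (X t).nBar
        = (X t).q (4 / 3) + 2 * (X t).sigmaPlus + 2 * √3 * (X t).crossRe / (X t).nBar := by
      rw [add_div, mul_div_cancel_right₀ _ hN0.ne']
      rfl
    have b3 : -(1 / 25) ≤ 2 * √3 * (X t).crossRe / (X t).nBar := by
      rw [le_div_iff₀ hN0]
      linarith [(abs_le.1 b1).1]
    have b4 : 21 / (X t).nBar ≤ 21 / 100 := by gcongr
    have b5 := (le_abs_self e).trans (he.trans b4)
    have b6 := sq_nonneg ‖(X t).sigmaOne‖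
    rw [b2]
    -- The main part 1 + 2Σ₊ + 2Σ₊² = 1/2 + (2Σ₊ + 1)²/2 is at least 1/2. With N̄ ≥ 100 the errors
    -- cost at most 21/100 + 1/25, leaving exactly 1/4.
    nlinarith [sq_nonneg (2 * (X t).sigmaPlus + 1)]
  choose! d hd hd0 using hder
  have hm := monotoneOn_Ici_of_hasDerivAt_nonneg hd hd0
  set c := Real.log (X a).nBar - correction (X a) / 2
      + averagedLogDensity (4 / 3) (X a) / 2 - 1 / 4 * a with hc
  refine ⟨Real.exp (1 - c), ?_⟩
  filter_upwards [eventually_ge_atTop a] with t ht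
  obtain ⟨h1, h2⟩ := ha t ht
  have had := (hX t h1).1
  have hN0 : 0 < (X t).nBar := by linarith
  have h3 : c ≤ _ := hm Set.self_mem_Ici ht ht
  have h4 := had.averagedLogDensity_le (by norm_num) le_rfl
  have h5 := (abs_le.1 (had.abs_correction_le (by linarith))).1
  have h6 : 1 / (X t).nBar ≤ 1 := by rw [div_le_one hN0]; linarith
  rw [← Real.exp_add, one_div, ← Real.exp_log (inv_pos.2 hN0), Real.log_inv, Real.exp_le_exp]
  linarith

lemma State.IsAdmissible.abs_deriv_sigmaPlus_le {x : State} (h : x.IsAdmissible (4 / 3)) :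
    |(x.q (4 / 3) - 2) * x.sigmaPlus + 3 * ‖x.sigmaOne‖ ^ 2 - 2 * ‖x.nCross‖ ^ 2
      + 4 / 3 * x.omega / (2 * x.Gplus (4 / 3)) * (-2 * x.vOne ^ 2 + ‖x.vC‖ ^ 2)| ≤ 9 := by
  have hG := h.Gplus_ge (by norm_num)
  have hq := h.q_le (by norm_num) le_rfl
  have hq0 := h.q_nonneg (by norm_num) le_rfl
  have hΩ := h.omega_pos
  have b1 : |(x.q (4 / 3) - 2) * x.sigmaPlus| ≤ 2 := by
    have : |x.q (4 / 3) - 2| ≤ 2 := by rw [abs_le]; constructor <;> linarith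
    rw [abs_mul]
    nlinarith [h.abs_sigmaPlus_le, abs_nonneg x.sigmaPlus]
  have b2 : ‖x.sigmaOne‖ ^ 2 ≤ 1 := pow_le_one₀ (norm_nonneg _) h.norm_sigmaOne_le
  have b3 : ‖x.nCross‖ ^ 2 ≤ 1 := pow_le_one₀ (norm_nonneg _) h.norm_nCross_le
  have b4 : |4 / 3 * x.omega / (2 * x.Gplus (4 / 3)) * (-2 * x.vOne ^ 2 + ‖x.vC‖ ^ 2)| ≤ 2 := by
    have c1 : 4 / 3 * x.omega / (2 * x.Gplus (4 / 3)) ≤ 1 := by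
      rw [div_le_one (by linarith)]
      linarith [h.omega_le]
    have c2 : |-2 * x.vOne ^ 2 + ‖x.vC‖ ^ 2| ≤ 2 := by
      have := h.Vsq_lt_one
      unfold Vsq at this
      rw [abs_le]
      constructor <;> nlinarith [sq_nonneg x.vOne, sq_nonneg ‖x.vC‖]
    have c3 : 0 ≤ 4 / 3 * x.omega / (2 * x.Gplus (4 / 3)) := by positivity
    rw [abs_mul, abs_of_nonneg c3]
    nlinarith [abs_nonneg (-2 * x.vOne ^ 2 + ‖x.vC‖ ^ 2)]
  rw [abs_le] at *
  constructor <;> linarith [sq_nonneg ‖x.sigmaOne‖, sq_nonneg ‖x.nCross‖]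

theorem IsModel.tendsto_sigmaPlus_of_radiation (hX : IsModel (4 / 3) τ₀ X)
    (hN : Tendsto (fun τ => (X τ).nBar) atTop atTop) :
    Tendsto (fun τ => (X τ).sigmaPlus) atTop (𝓝 0) := by
  obtain ⟨K, hK⟩ := hX.exists_inv_nBar_le hN
  obtain ⟨a, ha⟩ := eventually_atTop.1
    ((eventually_gt_atTop τ₀).and ((hN.eventually_ge_atTop 1).and hK))
  have hK0 : 0 ≤ K := by
    obtain ⟨-, h2, h3⟩ := ha a le_rfl
    have h4 : 0 < 1 / (X a).nBar := by positivity
    exact (pos_of_mul_pos_left (h4.trans_le h3) (Real.exp_pos _).le).le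
  -- Here 84 = 4 · 21: the exponential has derivative 21 K exp(-t/4), which absorbs the error 21/N̄.
  have hder : ∀ t ≥ a, ∃ d : ℝ, HasDerivAt (fun s => averagedLogDensity (4 / 3) (X s)
      - 84 * K * Real.exp (-(1 / 4) * s)) d t ∧ (X t).sigmaPlus ^ 2 ≤ d := by
    intro t ht
    obtain ⟨h1, h2, h3⟩ := ha t ht
    obtain ⟨e, he, -, hd⟩ := hX.hasDerivAt_averagedLogDensity (by norm_num) le_rfl h1 h2
    refine ⟨_, hd.sub ((((hasDerivAt_id t).const_mul (-(1 / 4))).exp).const_mul (84 * K)), ?_⟩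
    have h4 : 21 / (X t).nBar = 21 * (1 / (X t).nBar) := by ring
    have h5 := (le_abs_self e).trans he
    simp only [id]
    nlinarith [sq_nonneg (X t).sigmaPlus, sq_nonneg ‖(X t).sigmaOne‖]
  choose! d hd hd0 using hder
  refine tendsto_zero_of_sq_le_deriv (b := 1) (fun t ht => (hX t (ha t ht).1).2.sigmaPlus)
    (fun t ht => (hX t (ha t ht).1).1.abs_deriv_sigmaPlus_le)
    (fun t ht => (hX t (ha t ht).1).1.abs_sigmaPlus_le) hd hd0 fun t ht => ?_
  obtain ⟨h1, h2, h3⟩ := ha t ht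
  have had := (hX t h1).1
  have h4 := had.averagedLogDensity_le (by norm_num) le_rfl
  have h5 := (abs_le.1 (had.abs_correction_le h2)).1
  have h6 : 1 / (X t).nBar ≤ 1 := by rw [div_le_one (by linarith)]; exact h2
  have h7 : 0 ≤ 84 * K * Real.exp (-(1 / 4) * t) := by positivity
  linarith

end Model

end BianchiVII0

theorem theorem3 (γ τ₀ : ℝ) (hγ : 2 / 3 < γ) (hγ' : γ ≤ 4 / 3)
    (X : ℝ → BianchiVII0.State) (hX : BianchiVII0.IsModel γ τ₀ X)
    (hN : Filter.Tendsto (fun τ => (X τ).nBar) Filter.atTop Filter.atTop) :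
    (γ < 4 / 3 →
      Filter.Tendsto (fun τ => ((X τ).sigmaPlus, (X τ).V, (X τ).sigma1)) Filter.atTop
        (𝓝 ((0 : ℝ), (0 : ℝ), (0 : ℝ)))) ∧
    (γ = 4 / 3 →
      Filter.Tendsto (fun τ => (X τ).sigmaPlus) Filter.atTop (𝓝 (0 : ℝ))) := by
  refine ⟨fun h => hX.tendsto_isotropic hγ h hN, ?_⟩
  rintro rfl
  exact hX.tendsto_sigmaPlus_of_radiation hN
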